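/- Let $K$ be an algebraically closed field of characteristic zero, and let $X$ be an irreducible quasiaffine variety over $K$, with algebra of regular functions $A=K[X]$ (which need not be finitely generated). A $K$-derivation $\partial\colon A\to A$ is called locally nilpotent (an LND) if for every $a\in A$ there is a positive integer $m$ with $\partial^m(a)=0$. Let $\mathbb G_a$ be the additive group of $K$, with coordinate $t$. A derivation $\partial$ of $A$ corresponds to an action $\mathbb G_a\times X\to X$, $(t,x)\mapsto t\cdot x$, if it is the differential of this action, that is, for every $a\in A$, $$a(t\cdot x)\equiv a(x)+t\,(\partial a)(x) \pmod{t^2}\quad\text{in } K[\mathbb G_a\times X].$$ Then: (i) for every locally nilpotent derivation $\partial$ of $A$ there exists a nonzero $f\in\operatorname{Ker}(\partial)$ such that the derivation $f\partial$ corresponds to a $\mathbb G_a$-action on $X$; (ii) if a locally nilpotent derivation $\partial$ of $A$ corresponds to a $\mathbb G_a$-action on $X$, then for every $f\in\operatorname{Ker}(\partial)$ the derivation $f\partial$ corresponds to a $\mathbb G_a$-action on $X$; (iii) the variety $X$ admits a nontrivial $\mathbb G_a$-action if and only if there is a nonzero locally nilpotent derivation of $A$. -/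

import Mathlib

universe u

open CategoryTheory AlgebraicGeometry MonoidalCategory CartesianMonoidalCategory

noncomputable section

namespace QuasiAffineLND

section AdditiveGroup

variable (K : Type u) [Field K]

/-- The affine line over `K`, the underlying `K`-scheme of the additive group `𝔾ₐ`. -/
def Ga : Over (Spec (CommRingCat.of K)) :=
  Over.mk (𝔸(PUnit.{u + 1}; Spec (CommRingCat.of K)) ↘ Spec (CommRingCat.of K))

/-- The standard coordinate `t` on the affine line. -/
def Ga.coord : Γ((Ga K).left, ⊤) :=
  AffineSpace.coord (Spec (CommRingCat.of K)) PUnit.unit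

/-- The functor sending a `K`-scheme `T` to the additive group `Γ(T, 𝒪_T)`. -/
def additiveFunctor : (Over (Spec (CommRingCat.of K)))ᵒᵖ ⥤ AddGrpCat.{u} :=
  (Over.forget _).op ⋙ Scheme.Γ ⋙ forget₂ CommRingCat RingCat ⋙ forget₂ RingCat AddCommGrpCat ⋙
    forget₂ AddCommGrpCat AddGrpCat

/-- The `T`-points of the affine line are the global functions on `T`: a `K`-morphism
`s : T ⟶ Ga K` corresponds to the function `s^* t`. -/
def gaRepresentableBy :
    (additiveFunctor K ⋙ forget AddGrpCat.{u}).RepresentableBy (Ga K) where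
  homEquiv {T} :=
    { toFun := fun s => s.left.appTop (Ga.coord K)
      invFun := fun g => Over.homMk (AffineSpace.homOfVector T.hom fun _ => g)
        (AffineSpace.homOfVector_over _ _)
      left_inv := fun s => by
        ext1
        refine AffineSpace.hom_ext ?_ fun i => ?_
        · exact (AffineSpace.homOfVector_over _ _).trans (Over.w s).symm
        · exact AffineSpace.homOfVector_appTop_coord _ _ i
      right_inv := fun g => AffineSpace.homOfVector_appTop_coord T.hom (fun _ => g) PUnit.unit }
  homEquiv_comp {T T'} f g := by
    change (f ≫ g).left.appTop (Ga.coord K) = f.left.appTop (g.left.appTop (Ga.coord K))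
    rw [Over.comp_left, Scheme.Hom.comp_appTop]
    rfl

/-- The additive group `𝔾ₐ`: the affine line, with the group law which on `T`-points is the
addition of global functions on `T`. -/
instance : AddGrpObj (Ga K) :=
  AddGrpObj.ofRepresentableBy (Ga K) (additiveFunctor K) (gaRepresentableBy K)

end AdditiveGroup

variable {K : Type u} [Field K]

/-- The ring `K[X]` of regular functions on a `K`-scheme `X`. -/
abbrev RegularFunctions (X : Over (Spec (CommRingCat.of K))) : Type u := Γ(X.left, ⊤)

/-- `K[X]` is a `K`-algebra through the structure morphism `X ⟶ Spec K`. -/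
instance (X : Over (Spec (CommRingCat.of K))) : Algebra K (RegularFunctions X) :=
  ((Scheme.ΓSpecIso (CommRingCat.of K)).inv ≫ X.hom.appTop).hom.toAlgebra

/-- The pullback `φ^* : K[Y] → K[X]` of regular functions along a `K`-morphism `φ : X ⟶ Y`. -/
def comorphism {X Y : Over (Spec (CommRingCat.of K))} (φ : X ⟶ Y) :
    RegularFunctions Y →+* RegularFunctions X :=
  φ.left.appTop.hom

/-- A `𝔾ₐ`-action on `X`: a `K`-morphism `𝔾ₐ × X ⟶ X` satisfying the axioms of a group action. -/
abbrev GaAction (X : Over (Spec (CommRingCat.of K))) : Type u := AddModObj (Ga K) X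

/-- The action morphism `𝔾ₐ × X ⟶ X`. -/
def GaAction.act {X : Over (Spec (CommRingCat.of K))} (α : GaAction X) : Ga K ⊗ X ⟶ X := α.vadd

/-- An action is nontrivial if the action morphism is not the second projection. -/
def GaAction.IsNontrivial {X : Over (Spec (CommRingCat.of K))} (α : GaAction X) : Prop :=
  α.act ≠ snd (Ga K) X

/-- The parameter `t`, as a regular function on `𝔾ₐ × X`. -/
def parameter (X : Over (Spec (CommRingCat.of K))) : RegularFunctions (Ga K ⊗ X) :=
  comorphism (fst (Ga K) X) (Ga.coord K)

/-- The derivation `D` of `K[X]` corresponds to the `𝔾ₐ`-action `α` on `X`: it is the differential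
of `α` at `t = 0`, that is, `a (t • x) = a x + t * (D a) x` modulo `t ^ 2`, for all `a` in `K[X]`,
as regular functions of `(t, x)` on `𝔾ₐ × X`. -/
def CorrespondsTo {X : Over (Spec (CommRingCat.of K))}
    (D : Derivation K (RegularFunctions X) (RegularFunctions X)) (α : GaAction X) : Prop :=
  ∀ a : RegularFunctions X,
    comorphism α.act a -
        (comorphism (snd (Ga K) X) a + parameter X * comorphism (snd (Ga K) X) (D a)) ∈
      Ideal.span {parameter X ^ 2}

/-- `D` is locally nilpotent: every element is killed by some power of `D`. -/
def IsLocallyNilpotent {A : Type u} [CommRing A] [Algebra K A] (D : Derivation K A A) : Prop :=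
  ∀ a : A, ∃ m : ℕ, 0 < m ∧ (⇑D)^[m] a = 0

end QuasiAffineLND

end

/-! Write `A` for `K[X]`. Flat base change identifies the functions on `𝔾ₐ × X` with `A[t]`
(`polynomialToProd_bijective`), and since `X` is open in `Spec A`, a morphism to `X` is determined
by its comorphism. An action is thus a coaction `A → A[t]`, and in characteristic zero coactions are
exactly the exponentials `exp (tD)` of locally nilpotent `D` (`isCoaction_expHom`,
`IsCoaction.eq_expHom`). The one obstruction is that `exp (tD)` only yields a morphism `𝔾ₐ × X →
Spec A`, which may leave `X`.

For (i), choose a nonzero `f` in the kernel whose nonvanishing locus in `Spec A` lies in `X`. Modulo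
`f`, `exp (t f D)` is the identity, so points of `X` with `f = 0` stay fixed, while points with `f ≠
0` keep `f ≠ 0`; neither kind leaves `X` (`exists_isGivenBy_of_invariant`). To find `f`, let `I` be
generated by finitely many `g i` cutting out the complement of `X`, and let `p ∈ I` be nonzero of
least degree, the degree of `a` being the last `n` with `D^n a ≠ 0`. Pseudo-division by `p` leaves
remainders in `I` of smaller degree, hence zero, so `p ∣ b i * g i` with `b i` nonzero in the
kernel. As divisibility is local on `X`, `p` divides `∏ b i`, which is the required `f`.

For (ii), precompose the action with `(t, x) ↦ (f(x) t, x)`. Part (iii) follows from (i), since `A`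
is a domain, and from the fact that a coaction is determined by its linear coefficient. -/

noncomputable section

namespace QuasiAffineLND

open Polynomial

/-! ### Exponentials of locally nilpotent derivations and coactions of the additive group -/

section Exponential

variable {K : Type u} [Field K] {A : Type u} [CommRing A] [Algebra K A]

theorem iterate_derivation_mul (D : Derivation K A A) (n : ℕ) (a b : A) :
    D^[n] (a * b) =
      ∑ ij ∈ Finset.HasAntidiagonal.antidiagonal n, n.choose ij.1 • (D^[ij.1] a * D^[ij.2] b) := by
  induction n with
  | zero => simp
  | succ n ih =>
    rw [Finset.sum_antidiagonal_choose_succ_nsmul (fun i j => D^[i] a * D^[j] b),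
      Function.iterate_succ_apply', ih, map_sum, ← Finset.sum_add_distrib]
    refine Finset.sum_congr rfl fun ij _ => ?_
    rw [map_nsmul, Derivation.leibniz, Function.iterate_succ_apply', Function.iterate_succ_apply',
      smul_eq_mul, smul_eq_mul, ← Nat.choose_symm_of_eq_add (Finset.HasAntidiagonal.mem_antidiagonal.mp ‹_›).symm]
    rw [← smul_add, mul_comm (D^[ij.2] b)]

theorem iterate_derivation_smul (D : Derivation K A A) (n : ℕ) (c : K) (a : A) :
    D^[n] (c • a) = c • D^[n] a := by
  induction n with
  | zero => rfl
  | succ n ih => rw [Function.iterate_succ_apply', Function.iterate_succ_apply', ih, D.map_smul]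

theorem iterate_derivation_eq_zero_of_le {D : Derivation K A A} {m n : ℕ} (h : m ≤ n) {a : A}
    (ha : D^[m] a = 0) : D^[n] a = 0 := by
  rw [← Nat.sub_add_cancel h, Function.iterate_add_apply, ha, iterate_map_zero]

theorem iterate_smul_derivation {D : Derivation K A A} {f : A} (hf : D f = 0) (n : ℕ) (a : A) :
    (f • D)^[n] a = f ^ n * D^[n] a := by
  induction n with
  | zero => simp
  | succ n ih =>
    rw [Function.iterate_succ_apply', Function.iterate_succ_apply', ih, Derivation.smul_apply,
      Derivation.leibniz, Derivation.leibniz_pow, hf]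
    simp only [smul_eq_mul, mul_zero, smul_zero, add_zero]
    ring

theorem IsLocallyNilpotent.smul {D : Derivation K A A} (hD : IsLocallyNilpotent D) {f : A}
    (hf : D f = 0) : IsLocallyNilpotent (f • D) := fun a => by
  obtain ⟨m, hm, h⟩ := hD a
  exact ⟨m, hm, by rw [iterate_smul_derivation hf, h, mul_zero]⟩

/-- The Leibniz expansion stops after two terms because `D^2 s = 0`. -/
theorem iterate_derivation_slice_mul {D : Derivation K A A} {s : A} (hs : D (D s) = 0)
    (n : ℕ) (p : A) :
    D^[n + 1] (s * p) = s * D^[n + 1] p + (n + 1 : ℕ) * (D s * D^[n] p) := by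
  induction n with
  | zero => simp; ring
  | succ n ih =>
    rw [Function.iterate_succ_apply', ih, map_add, Derivation.leibniz, Derivation.leibniz,
      Derivation.leibniz, hs, Derivation.map_natCast, ← Function.iterate_succ_apply' D,
      ← Function.iterate_succ_apply' D]
    simp only [smul_eq_mul]
    push_cast
    ring

theorem exists_iterate_ne_zero {D : Derivation K A A} (hD : IsLocallyNilpotent D) {a : A}
    (ha : a ≠ 0) : ∃ n, D^[n] a ≠ 0 ∧ D^[n + 1] a = 0 := by
  classical
  have h : ∃ n, D^[n] a = 0 := (hD a).imp fun _ h => h.2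
  have h0 : Nat.find h ≠ 0 := fun h0 => ha (by simpa [h0] using Nat.find_spec h)
  refine ⟨Nat.find h - 1, Nat.find_min h (Nat.pred_lt h0), ?_⟩
  rw [Nat.sub_add_cancel (Nat.pos_of_ne_zero h0)]
  exact Nat.find_spec h

/-- A local slice: differentiate an element outside the kernel until one step before it enters the
kernel. -/
theorem exists_slice {D : Derivation K A A} (hD : IsLocallyNilpotent D) (hD0 : D ≠ 0) :
    ∃ s, D (D s) = 0 ∧ D s ≠ 0 := by
  obtain ⟨a, ha⟩ : ∃ a, D a ≠ 0 := by
    by_contra! h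
    exact hD0 (Derivation.ext h)
  obtain ⟨n, h1, h2⟩ := exists_iterate_ne_zero hD ha
  refine ⟨D^[n] a, ?_, ?_⟩
  · rw [← Function.iterate_succ_apply' D, ← Function.iterate_succ_apply' D]
    exact h2
  · rwa [← Function.iterate_succ_apply' D]

/-- The polynomial `∑ n, (D ^ n a / n!) t ^ n` attached to an element `a` and a locally nilpotent
derivation `D`. -/
def expFun (D : Derivation K A A) (hD : IsLocallyNilpotent D) (a : A) : A[X] :=
  ∑ n ∈ Finset.range (hD a).choose, monomial n ((n.factorial : K)⁻¹ • D^[n] a)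

theorem coeff_expFun (D : Derivation K A A) (hD : IsLocallyNilpotent D) (a : A) (n : ℕ) :
    (expFun D hD a).coeff n = (n.factorial : K)⁻¹ • D^[n] a := by
  simp only [expFun, finsetSum_coeff, coeff_monomial, Finset.sum_ite_eq', Finset.mem_range]
  split_ifs with h
  · rfl
  · rw [iterate_derivation_eq_zero_of_le (not_lt.mp h) (hD a).choose_spec.2, smul_zero]

/-- The exponential `exp (t D) : A → A[t]` of a locally nilpotent derivation. -/
def expHom [CharZero K] (D : Derivation K A A) (hD : IsLocallyNilpotent D) : A →+* A[X] where
  toFun := expFun D hD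
  map_zero' := by ext n; simp [coeff_expFun]
  map_add' a b := by ext n; simp [coeff_expFun]
  map_one' := by
    ext n
    rw [coeff_expFun]
    cases n with
    | zero => simp
    | succ n =>
      rw [Function.iterate_succ_apply, D.map_one_eq_zero, iterate_map_zero, smul_zero,
        coeff_one, if_neg n.succ_ne_zero]
  map_mul' a b := by
    ext n
    rw [coeff_expFun, coeff_mul, iterate_derivation_mul, Finset.smul_sum]
    refine Finset.sum_congr rfl fun ij h => ?_
    rw [Finset.HasAntidiagonal.mem_antidiagonal] at h
    rw [coeff_expFun, coeff_expFun, smul_mul_smul_comm, ← Nat.cast_smul_eq_nsmul K, smul_smul]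
    congr 1
    subst h
    rw [Nat.choose_symm_add, Nat.add_choose, Nat.cast_div (Nat.factorial_mul_factorial_dvd_factorial_add _ _)
      (by exact_mod_cast (Nat.mul_pos (Nat.factorial_pos _) (Nat.factorial_pos _)).ne')]
    have := Nat.factorial_ne_zero (ij.1 + ij.2)
    have := Nat.factorial_ne_zero ij.1
    have := Nat.factorial_ne_zero ij.2
    push_cast
    field_simp

theorem coeff_expHom [CharZero K] (D : Derivation K A A) (hD : IsLocallyNilpotent D) (a : A) (n : ℕ) :
    (expHom D hD a).coeff n = (n.factorial : K)⁻¹ • D^[n] a :=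
  coeff_expFun D hD a n

theorem expHom_of_apply_eq_zero [CharZero K] (D : Derivation K A A) (hD : IsLocallyNilpotent D) {a : A}
    (ha : D a = 0) : expHom D hD a = C a := by
  ext n
  rw [coeff_expHom, coeff_C]
  cases n with
  | zero => simp
  | succ n =>
    rw [Function.iterate_succ_apply, ha, iterate_map_zero, smul_zero,
      if_neg n.succ_ne_zero]

theorem expHom_smul [CharZero K] (D : Derivation K A A) (hD : IsLocallyNilpotent D) {f : A} (hf : D f = 0)
    (a : A) : expHom (f • D) (hD.smul hf) a = (expHom D hD a).comp (C f * X) := by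
  ext n
  rw [comp_C_mul_X_coeff, coeff_expHom, coeff_expHom, iterate_smul_derivation hf,
    smul_mul_assoc, mul_comm]

/-- A ring homomorphism `A → A[t]` satisfying the axioms of a coaction of the additive group. -/
structure IsCoaction (P : A →+* A[X]) : Prop where
  coeff_zero (a : A) : (P a).coeff 0 = a
  map_coeff (a : A) (n : ℕ) : P ((P a).coeff n) = hasseDeriv n (P a)

/-- Comparing coefficients reduces this to `1 / (m! n!) = choose (m + n) n / (m + n)!`. -/
theorem isCoaction_expHom [CharZero K] (D : Derivation K A A) (hD : IsLocallyNilpotent D) :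
    IsCoaction (expHom D hD) where
  coeff_zero a := by simp [coeff_expHom]
  map_coeff a n := by
    ext m
    rw [hasseDeriv_coeff, coeff_expHom, coeff_expHom, coeff_expHom, iterate_derivation_smul,
      smul_smul, ← Function.iterate_add_apply, ← nsmul_eq_mul, ← Nat.cast_smul_eq_nsmul K,
      smul_smul]
    congr 1
    rw [Nat.add_choose,
      Nat.cast_div (Nat.factorial_mul_factorial_dvd_factorial_add _ _)
      (by exact_mod_cast (Nat.mul_pos (Nat.factorial_pos _) (Nat.factorial_pos _)).ne')]
    have := Nat.factorial_ne_zero (m + n)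
    have := Nat.factorial_ne_zero m
    have := Nat.factorial_ne_zero n
    push_cast
    field_simp

/-- The coaction axiom for the linear coefficient says that the `n`-th coefficient of `P (D a)` is
`n + 1` times the next coefficient of `P a`; dividing by `n + 1` gives the induction. -/
theorem IsCoaction.coeff_eq [CharZero K] {P : A →+* A[X]} (hP : IsCoaction P) (D : Derivation K A A)
    (hD : ∀ a, D a = (P a).coeff 1) (a : A) (n : ℕ) :
    (P a).coeff n = (n.factorial : K)⁻¹ • D^[n] a := by
  induction n generalizing a with
  | zero => simp [hP.coeff_zero]
  | succ n ih =>
    have h := congrArg (fun p => p.coeff n) (hP.map_coeff a 1)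
    simp only [← hD, hasseDeriv_coeff, Nat.choose_one_right] at h
    rw [ih, ← Function.iterate_succ_apply] at h
    have hn : ((n + 1 : ℕ) : K) ≠ 0 := Nat.cast_ne_zero.mpr n.succ_ne_zero
    rw [← nsmul_eq_mul, ← Nat.cast_smul_eq_nsmul K] at h
    rw [Nat.factorial_succ, Nat.cast_mul, mul_inv, mul_smul, h, smul_smul,
      inv_mul_cancel₀ hn, one_smul]

theorem IsCoaction.isLocallyNilpotent [CharZero K] {P : A →+* A[X]} (hP : IsCoaction P) (D : Derivation K A A)
    (hD : ∀ a, D a = (P a).coeff 1) : IsLocallyNilpotent D := fun a => by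
  refine ⟨(P a).natDegree + 1, Nat.succ_pos _, ?_⟩
  have h := hP.coeff_eq D hD a ((P a).natDegree + 1)
  rw [coeff_eq_zero_of_natDegree_lt (Nat.lt_succ_self _)] at h
  exact (smul_eq_zero.mp h.symm).resolve_left
    (inv_ne_zero (Nat.cast_ne_zero.mpr (Nat.factorial_ne_zero _)))

theorem IsCoaction.eq_expHom [CharZero K] {P : A →+* A[X]} (hP : IsCoaction P) (D : Derivation K A A)
    (hD : ∀ a, D a = (P a).coeff 1) (h : IsLocallyNilpotent D) : P = expHom D h := by
  ext a n
  rw [hP.coeff_eq D hD, coeff_expHom]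

/-- The derivation `a ↦ (P a).coeff 1` attached to a coaction `P`. -/
def IsCoaction.derivation {P : A →+* A[X]} (hP : IsCoaction P)
    (hK : ∀ c : K, P (algebraMap K A c) = C (algebraMap K A c)) : Derivation K A A :=
  Derivation.mk'
    { toFun := fun a => (P a).coeff 1
      map_add' := fun a b => by simp
      map_smul' := fun c a => by
        rw [Algebra.smul_def, map_mul, hK, coeff_C_mul, RingHom.id_apply, Algebra.smul_def] }
    fun a b => by
      change (P (a * b)).coeff 1 = a * (P b).coeff 1 + b * (P a).coeff 1
      rw [map_mul, coeff_mul, Finset.Nat.antidiagonal_succ]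
      simp [hP.coeff_zero, mul_comm]

theorem taylor_X_map_C_coeff (p : A[X]) (n : ℕ) :
    (taylor X (p.map C)).coeff n = hasseDeriv n p := by
  rw [taylor_coeff, ← eval₂_C_X (p := hasseDeriv n p), ← Polynomial.eval_map]
  congr 1
  ext m
  simp [hasseDeriv_coeff]

/-- Hasse derivatives are the Taylor coefficients, so `map_coeff` is the coefficientwise form of
associativity: applying `P` twice substitutes `t + s` for `t`. -/
theorem isCoaction_iff_taylor {P : A →+* A[X]} :
    IsCoaction P ↔ (∀ a, (P a).coeff 0 = a) ∧ ∀ a, (P a).map P = taylor X ((P a).map C) := by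
  constructor
  · intro h
    refine ⟨h.coeff_zero, fun a => ?_⟩
    ext1 n
    rw [taylor_X_map_C_coeff, coeff_map, h.map_coeff]
  · intro h
    refine ⟨h.1, fun a n => ?_⟩
    rw [← taylor_X_map_C_coeff, ← h.2, coeff_map]

end Exponential

/-! ### Ideals that meet the kernel of a locally nilpotent derivation -/

section Kernel

variable {K : Type u} [Field K] [CharZero K] {A : Type u} [CommRing A] [IsDomain A] [Algebra K A]

/-- Each multiplication by the slice raises the degree by exactly one: the new top derivative is a
positive integer times `D s` times the old one, nonzero in a domain of characteristic zero. -/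
theorem exists_multiple_iterate_ne_zero {D : Derivation K A A} {s : A} (hs : D (D s) = 0)
    (hs' : D s ≠ 0) {p : A} {e : ℕ} (he : D^[e] p ≠ 0) (he' : D^[e + 1] p = 0) (k : ℕ) :
    ∃ q : A, p ∣ q ∧ D^[e + k] q ≠ 0 ∧ D^[e + k + 1] q = 0 := by
  have : CharZero A := charZero_of_injective_algebraMap (algebraMap K A).injective
  induction k with
  | zero => exact ⟨p, dvd_rfl, he, he'⟩
  | succ k ih =>
    obtain ⟨q, hq, h1, h2⟩ := ih
    refine ⟨s * q, hq.mul_left s, ?_, ?_⟩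
    · rw [← add_assoc, iterate_derivation_slice_mul hs, h2, mul_zero, zero_add]
      exact mul_ne_zero (Nat.cast_ne_zero.mpr (Nat.succ_ne_zero _)) (mul_ne_zero hs' h1)
    · rw [← add_assoc, iterate_derivation_slice_mul hs, h2,
        iterate_derivation_eq_zero_of_le (Nat.le_succ _) h2, mul_zero, mul_zero, mul_zero, zero_add]

/-- Pseudo-division by `p`: modulo `p` and up to a factor in the kernel, every element has degree
smaller than that of `p`. -/
theorem exists_pseudo_remainder {D : Derivation K A A} {s : A}
    (hs : D (D s) = 0) (hs' : D s ≠ 0) {p : A} {e : ℕ} (he : D^[e] p ≠ 0)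
    (he' : D^[e + 1] p = 0) (n : ℕ) (a : A) (ha : D^[n] a = 0) :
    ∃ b, b ≠ 0 ∧ D b = 0 ∧ ∃ r, D^[e] r = 0 ∧ p ∣ b * a - r := by
  induction n generalizing a with
  | zero => exact ⟨1, one_ne_zero, D.map_one_eq_zero, a,
      iterate_derivation_eq_zero_of_le (Nat.zero_le _) ha, by simp⟩
  | succ n ih =>
    rcases lt_or_ge n e with hn | hn
    · exact ⟨1, one_ne_zero, D.map_one_eq_zero, a,
        iterate_derivation_eq_zero_of_le hn ha, by simp⟩
    · obtain ⟨q, hpq, h1, h2⟩ := exists_multiple_iterate_ne_zero hs hs' he he' (n - e)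
      rw [Nat.add_sub_cancel' hn] at h1 h2
      have key : ∀ x : A, D^[n + 1] x = 0 → ∀ y, D^[n] (D^[n] x * y) = D^[n] x * D^[n] y := by
        intro x hx y
        have hx' : D (D^[n] x) = 0 := by rwa [← Function.iterate_succ_apply' D]
        have : ∀ m, D^[m] (D^[n] x * y) = D^[n] x * D^[m] y := by
          intro m
          induction m with
          | zero => rfl
          | succ m ihm =>
            rw [Function.iterate_succ_apply', ihm, Derivation.leibniz, hx', smul_zero, add_zero,
              smul_eq_mul, Function.iterate_succ_apply']
        exact this n
      -- The top derivatives of `q` and `a` lie in the kernel and serve as leading coefficients;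
      -- cross-multiplying cancels the leading terms.
      obtain ⟨b, hb, hDb, r, hr, hd⟩ := ih (D^[n] q * a - D^[n] a * q) (by
        rw [sub_eq_add_neg, iterate_map_add, ← neg_one_smul K, iterate_derivation_smul,
          key q h2, key a ha, neg_one_smul]
        ring)
      refine ⟨b * D^[n] q, mul_ne_zero hb h1, ?_, r, hr, ?_⟩
      · rw [Derivation.leibniz, hDb, ← Function.iterate_succ_apply' D, h2]
        simp
      · have : b * D^[n] q * a - r =
            (b * (D^[n] q * a - D^[n] a * q) - r) + b * D^[n] a * q := by ring
        rw [this]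
        exact dvd_add hd (hpq.mul_left _)

/-- If division by a nonzero element can be tested after multiplication with the elements of a
finite family, then the ideal generated by that family meets the kernel of every locally nilpotent
derivation. -/
theorem exists_mem_span_of_saturated {D : Derivation K A A} (hD : IsLocallyNilpotent D)
    {ι : Type*} [Finite ι] (g : ι → A) (hg : ∃ i, g i ≠ 0)
    (sat : ∀ b p : A, p ≠ 0 → (∀ i, p ∣ b * g i) → p ∣ b) :
    ∃ f ∈ Ideal.span (Set.range g), f ≠ 0 ∧ D f = 0 := by
  classical
  by_cases hD0 : D = 0
  · obtain ⟨i, hi⟩ := hg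
    exact ⟨g i, Ideal.subset_span ⟨i, rfl⟩, hi, by simp [hD0]⟩
  obtain ⟨s, hs, hs'⟩ := exists_slice hD hD0
  have hex : ∃ e, ∃ p ∈ Ideal.span (Set.range g), D^[e] p ≠ 0 ∧ D^[e + 1] p = 0 := by
    obtain ⟨i, hi⟩ := hg
    obtain ⟨n, hn⟩ := exists_iterate_ne_zero hD hi
    exact ⟨n, g i, Ideal.subset_span ⟨i, rfl⟩, hn⟩
  -- `p` has least degree among the nonzero elements of the ideal.
  obtain ⟨p, hpI, he, he'⟩ := Nat.find_spec hex
  have hmin : ∀ r ∈ Ideal.span (Set.range g), D^[Nat.find hex] r = 0 → r = 0 := by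
    intro r hr h
    by_contra hr0
    obtain ⟨n, hn⟩ := exists_iterate_ne_zero hD hr0
    refine Nat.find_min hex (m := n) ?_ ⟨r, hr, hn⟩
    by_contra hle
    exact hn.1 (iterate_derivation_eq_zero_of_le (not_lt.mp hle) h)
  have hp0 : p ≠ 0 := fun h => he (by rw [h, iterate_map_zero])
  have hdiv : ∀ i, ∃ b, b ≠ 0 ∧ D b = 0 ∧ p ∣ b * g i := by
    intro i
    obtain ⟨n, -, hn⟩ := hD (g i)
    obtain ⟨b, hb, hDb, r, hr, hd⟩ := exists_pseudo_remainder hs hs' he he' n (g i) hn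
    have hrI : r ∈ Ideal.span (Set.range g) := by
      have h1 : b * g i ∈ Ideal.span (Set.range g) :=
        Ideal.mul_mem_left _ _ (Ideal.subset_span ⟨i, rfl⟩)
      have h2 := Ideal.mem_of_dvd _ hd hpI
      simpa using Ideal.sub_mem _ h1 h2
    rw [hmin r hrI hr, sub_zero] at hd
    exact ⟨b, hb, hDb, hd⟩
  choose b hb hDb hd using hdiv
  have := Fintype.ofFinite ι
  refine ⟨∏ i, b i, ?_, Finset.prod_ne_zero_iff.mpr fun i _ => hb i, ?_⟩
  -- Saturation turns `p ∣ (∏ b) * g i` for all `i` into `p ∣ ∏ b`, which puts the product in the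
  -- ideal.
  · refine Ideal.mem_of_dvd _ (sat _ p hp0 fun i => ?_) hpI
    exact (hd i).trans (mul_dvd_mul_right (Finset.dvd_prod_of_mem b (Finset.mem_univ i)) _)
  · refine Finset.prod_induction b (fun x => D x = 0) (fun x y hx hy => ?_) D.map_one_eq_zero
      fun i _ => hDb i
    rw [Derivation.leibniz, hx, hy, smul_zero, smul_zero, add_zero]

end Kernel

/-! ### Flat base change and functions on affine space -/

section AffineSpace

theorem appLE_top_top {X Y : Scheme.{u}} (f : X ⟶ Y) (h : ⊤ ≤ f ⁻¹ᵁ ⊤) :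
    f.appLE ⊤ ⊤ h = f.appTop := by
  have : (homOfLE h).op = 𝟙 _ := rfl
  rw [Scheme.Hom.appLE, this]
  exact (congrArg _ (X.presheaf.map_id _)).trans (Category.comp_id _)

/-- Flat base change for global functions. -/
theorem isPushout_appTop_of_isPullback {X Y S T : Scheme.{u}} {f : T ⟶ S} {g : Y ⟶ X} {iX : X ⟶ S}
    {iY : Y ⟶ T} (H : IsPullback g iY iX f) [Flat f] [IsAffine S] [IsAffine T]
    [CompactSpace X] [QuasiSeparatedSpace X] :
    IsPushout iX.appTop f.appTop g.appTop iY.appTop := by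
  have hX : ⊤ ≤ iX ⁻¹ᵁ ⊤ := le_rfl
  have hT : ⊤ ≤ f ⁻¹ᵁ ⊤ := le_rfl
  have h := (isIso_pushoutSection_iff H (US := ⊤) (UT := ⊤) (UX := ⊤)
    (UY := ⊤) hT hX (by simp)).mp
    (isIso_pushoutSection_of_isQuasiSeparated_of_flat_right H hT hX
      (by simp) (isAffineOpen_top _) (isAffineOpen_top _) isCompact_univ isQuasiSeparated_univ)
  rw [appLE_top_top, appLE_top_top, appLE_top_top, appLE_top_top] at h
  exact h

theorem flat_affineSpace_over (n : Type u) (R : CommRingCat.{u}) : Flat (𝔸(n; Spec R) ↘ Spec R) := by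
  have h : (AffineSpace.SpecIso n R).hom ≫ Spec.map (CommRingCat.ofHom MvPolynomial.C) =
      𝔸(n; Spec R) ↘ Spec R := by
    rw [← AffineSpace.SpecIso_inv_over, Iso.hom_inv_id_assoc]
  have : Flat (Spec.map (CommRingCat.ofHom (MvPolynomial.C (σ := n) (R := R)))) := by
    rw [Flat.SpecMap_iff]
    change (algebraMap R (MvPolynomial n R)).Flat
    rw [RingHom.flat_algebraMap_iff]
    infer_instance
  rw [← h]
  infer_instance

theorem affineSpace_appTop_hom_ext (n : Type u) (S : Scheme.{u}) [IsAffine S] {R : CommRingCat.{u}}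
    {f g : Γ(𝔸(n; S), ⊤) ⟶ R}
    (h : (𝔸(n; S) ↘ S).appTop ≫ f = (𝔸(n; S) ↘ S).appTop ≫ g)
    (h' : ∀ i, f (AffineSpace.coord S i) = g (AffineSpace.coord S i)) : f = g := by
  have : IsIso (AffineSpace.isoOfIsAffine n S).hom.appTop :=
    inferInstanceAs (IsIso ((AffineSpace.isoOfIsAffine n S).hom.app ⊤))
  rw [← cancel_epi (AffineSpace.isoOfIsAffine n S).hom.appTop,
    AffineSpace.isoOfIsAffine_hom_appTop, Category.assoc, Category.assoc]
  congr 1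
  refine CommRingCat.hom_ext (MvPolynomial.ringHom_ext (fun x => ?_) fun i => ?_)
  · simpa using congr($h x)
  · simpa using h' i

/-- The morphism from an affine scheme to affine space with prescribed coordinates and prescribed
composition with the projection to the base, on the level of global functions. -/
theorem exists_appTop_affineSpace (n : Type u) (S : Scheme.{u}) [IsAffine S] {R : CommRingCat.{u}}
    (c : Γ(S, ⊤) ⟶ R) (v : n → R) :
    ∃ β : Γ(𝔸(n; S), ⊤) ⟶ R,
      (𝔸(n; S) ↘ S).appTop ≫ β = c ∧ ∀ i, β (AffineSpace.coord S i) = v i := by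
  let s : Spec R ⟶ S := Spec.map c ≫ S.isoSpec.inv
  have hs : s.appTop ≫ (Scheme.ΓSpecIso R).hom = c := by
    have h1 : s ≫ S.toSpecΓ = Spec.map c := by simp [s, ← Scheme.isoSpec_hom]
    have : IsIso S.toSpecΓ.appTop := inferInstanceAs (IsIso (S.toSpecΓ.app ⊤))
    rw [← cancel_epi S.toSpecΓ.appTop, ← Scheme.Hom.comp_appTop_assoc, h1,
      Scheme.ΓSpecIso_naturality]
    simp
  refine ⟨(AffineSpace.homOfVector s fun i => (Scheme.ΓSpecIso R).inv (v i)).appTop ≫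
    (Scheme.ΓSpecIso R).hom, ?_, fun i => ?_⟩
  · rw [← Scheme.Hom.comp_appTop_assoc, AffineSpace.homOfVector_over, hs]
  · simp

end AffineSpace

/-! ### Functions on `𝔾ₐ × Y` as polynomials over `K[Y]` -/

section FunctionsOnProduct

variable {K : Type u} [Field K]

instance : Flat (Ga K).hom := flat_affineSpace_over PUnit.{u + 1} (CommRingCat.of K)

instance : IsAffineHom (Ga K).hom :=
  inferInstanceAs (IsAffineHom
    (𝔸(PUnit.{u + 1}; Spec (CommRingCat.of K)) ↘ Spec (CommRingCat.of K)))

instance : IsAffine (Ga K).left :=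
  inferInstanceAs (IsAffine 𝔸(PUnit.{u + 1}; Spec (CommRingCat.of K)))

theorem isPullback_snd_left (Y : Over (Spec (CommRingCat.of K))) :
    IsPullback (snd (Ga K) Y).left (fst (Ga K) Y).left Y.hom (Ga K).hom :=
  (IsPullback.of_hasPullback (Ga K).hom Y.hom).flip

instance (Y : Over (Spec (CommRingCat.of K))) : IsAffineHom (snd (Ga K) Y).left :=
  MorphismProperty.of_isPullback (isPullback_snd_left Y).flip inferInstance

instance (Y : Over (Spec (CommRingCat.of K))) [CompactSpace Y.left] :
    CompactSpace (Ga K ⊗ Y).left :=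
  QuasiCompact.compactSpace_of_compactSpace (snd (Ga K) Y).left

instance (Y : Over (Spec (CommRingCat.of K))) [QuasiSeparatedSpace Y.left] :
    QuasiSeparatedSpace (Ga K ⊗ Y).left :=
  quasiSeparatedSpace_of_quasiSeparated (snd (Ga K) Y).left

theorem isPushout_appTop (Y : Over (Spec (CommRingCat.of K)))
    [CompactSpace Y.left] [QuasiSeparatedSpace Y.left] :
    IsPushout Y.hom.appTop (Ga K).hom.appTop
      (snd (Ga K) Y).left.appTop (fst (Ga K) Y).left.appTop := by
  exact isPushout_appTop_of_isPullback (S := Spec (CommRingCat.of K)) (isPullback_snd_left Y)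

theorem regularFunctions_ga_hom_ext {R : CommRingCat.{u}} {f g : Γ((Ga K).left, ⊤) ⟶ R}
    (h : (Ga K).hom.appTop ≫ f = (Ga K).hom.appTop ≫ g)
    (h' : f (Ga.coord K) = g (Ga.coord K)) : f = g :=
  affineSpace_appTop_hom_ext PUnit.{u + 1} (Spec (CommRingCat.of K)) h fun _ => h'

/-- The ring of polynomials in `t` over `K[Y]`, mapped to the regular functions on `𝔾ₐ × Y`. -/
def polynomialToProd (Y : Over (Spec (CommRingCat.of K))) :
    (RegularFunctions Y)[X] →+* RegularFunctions (Ga K ⊗ Y) :=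
  eval₂RingHom (comorphism (snd (Ga K) Y)) (parameter Y)

theorem polynomialToProd_C (Y : Over (Spec (CommRingCat.of K))) (a : RegularFunctions Y) :
    polynomialToProd Y (C a) = comorphism (snd (Ga K) Y) a :=
  eval₂_C _ _

theorem polynomialToProd_X (Y : Over (Spec (CommRingCat.of K))) :
    polynomialToProd Y X = parameter Y :=
  eval₂_X _ _

/-- By flat base change the functions on the product form a pushout even for non-affine `Y`; its
universal property supplies the inverse. -/
theorem polynomialToProd_bijective (Y : Over (Spec (CommRingCat.of K)))
    [CompactSpace Y.left] [QuasiSeparatedSpace Y.left] :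
    Function.Bijective (polynomialToProd Y) := by
  let R : CommRingCat.{u} := CommRingCat.of (RegularFunctions Y)[X]
  let c : Γ(Y.left, ⊤) ⟶ R := CommRingCat.ofHom C
  obtain ⟨β, hβ, hβX⟩ : ∃ β : Γ((Ga K).left, ⊤) ⟶ R,
      (Ga K).hom.appTop ≫ β = Y.hom.appTop ≫ c ∧ β (Ga.coord K) = X := by
    obtain ⟨β, h1, h2⟩ := exists_appTop_affineSpace PUnit.{u + 1} (Spec (CommRingCat.of K))
      (Y.hom.appTop ≫ c) fun _ => (X : (RegularFunctions Y)[X])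
    exact ⟨β, h1, h2 PUnit.unit⟩
  let inv : Γ((Ga K ⊗ Y).left, ⊤) ⟶ R := (isPushout_appTop Y).desc c β hβ.symm
  have hl : (snd (Ga K) Y).left.appTop ≫ inv = c := (isPushout_appTop Y).inl_desc c β hβ.symm
  have hr : (fst (Ga K) Y).left.appTop ≫ inv = β := (isPushout_appTop Y).inr_desc c β hβ.symm
  have hc : c ≫ CommRingCat.ofHom (polynomialToProd Y) = (snd (Ga K) Y).left.appTop :=
    CommRingCat.hom_ext (RingHom.ext (polynomialToProd_C Y))
  have h1 : inv.hom.comp (polynomialToProd Y) = RingHom.id _ := by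
    refine Polynomial.ringHom_ext (fun a => ?_) ?_
    · exact (congrArg inv (polynomialToProd_C Y a)).trans congr($hl a)
    · exact (congrArg inv (polynomialToProd_X Y)).trans (congr($hr (Ga.coord K)).trans hβX)
  have h2 : inv ≫ CommRingCat.ofHom (polynomialToProd Y) = 𝟙 _ := by
    refine (isPushout_appTop Y).hom_ext ?_ (regularFunctions_ga_hom_ext ?_ ?_)
    · rw [reassoc_of% hl, hc, Category.comp_id]
    · rw [reassoc_of% hr, reassoc_of% hβ, hc, Category.comp_id, (isPushout_appTop Y).w]
    · rw [reassoc_of% hr, Category.comp_id]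
      exact (congrArg (polynomialToProd Y) hβX).trans (polynomialToProd_X Y)
  exact ⟨Function.LeftInverse.injective (g := inv.hom) fun x => congr($h1 x),
    Function.RightInverse.surjective (g := inv.hom) fun x => congr($h2 x)⟩

end FunctionsOnProduct

/-! ### Comorphisms, and the dictionary between actions and coactions -/

theorem eval₂_taylor_X_map_C {A R : Type*} [CommRing A] [CommRing R] (φ : A →+* R) (s t : R)
    (p : A[X]) :
    (taylor X (p.map C)).eval₂ (eval₂RingHom φ s) t = p.eval₂ φ (t + s) := by
  rw [taylor_apply, eval₂_comp, eval₂_map]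
  congr 1
  · ext a
    simp
  · simp

section Comorphism

variable {K : Type u} [Field K] {X Y T : Over (Spec (CommRingCat.of K))}

theorem comorphism_comp (φ : T ⟶ Y) (ψ : Y ⟶ X) (a : RegularFunctions X) :
    comorphism (φ ≫ ψ) a = comorphism φ (comorphism ψ a) :=
  congr($(Scheme.Hom.comp_appTop φ.left ψ.left) a)

theorem comorphism_id (a : RegularFunctions X) : comorphism (𝟙 X) a = a :=
  congr($(Scheme.Hom.id_appTop (X := X.left)) a)

theorem comorphism_algebraMap (φ : T ⟶ Y) (c : K) :
    comorphism φ (algebraMap K (RegularFunctions Y) c) = algebraMap K (RegularFunctions T) c := by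
  have h : φ.left ≫ Y.hom = T.hom := Over.w φ
  have h' : Y.hom.appTop ≫ φ.left.appTop = T.hom.appTop := by
    rw [← h]
    exact (Scheme.Hom.comp_appTop φ.left Y.hom).symm
  exact congr($h' ((Scheme.ΓSpecIso (CommRingCat.of K)).inv c))

/-- The canonical map from `X` to the spectrum of `K[X]` is a monomorphism, and maps to that
spectrum are seen on global functions. -/
theorem hom_ext_of_comorphism [X.left.IsQuasiAffine] {φ ψ : T ⟶ X}
    (h : ∀ a, comorphism φ a = comorphism ψ a) : φ = ψ := by
  have h' : φ.left.appTop = ψ.left.appTop := CommRingCat.hom_ext (RingHom.ext h)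
  ext1
  rw [← cancel_mono X.left.toSpecΓ, Scheme.toSpecΓ_naturality, Scheme.toSpecΓ_naturality, h']

theorem comorphism_zero_coord :
    comorphism (AddMonObj.zero (X := Ga K)) (Ga.coord K) = 0 :=
  (gaRepresentableBy K).homEquiv.apply_symm_apply _

theorem comorphism_add_coord :
    comorphism (AddMonObj.add (X := Ga K)) (Ga.coord K) =
      comorphism (fst (Ga K) (Ga K)) (Ga.coord K) + comorphism (snd (Ga K) (Ga K)) (Ga.coord K) :=
  (gaRepresentableBy K).homEquiv.apply_symm_apply _

theorem comorphism_lift_polynomialToProd (g : T ⟶ Ga K) (x : T ⟶ Y) (p : (RegularFunctions Y)[X]) :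
    comorphism (lift g x) (polynomialToProd Y p) =
      p.eval₂ (comorphism x) (comorphism g (Ga.coord K)) := by
  have h : (comorphism (lift g x)).comp (polynomialToProd Y) =
      eval₂RingHom (comorphism x) (comorphism g (Ga.coord K)) := by
    refine Polynomial.ringHom_ext (fun a => ?_) ?_
    · rw [RingHom.comp_apply, polynomialToProd_C, ← comorphism_comp, lift_snd, coe_eval₂RingHom,
        eval₂_C]
    · rw [RingHom.comp_apply, polynomialToProd_X, parameter, ← comorphism_comp, lift_fst,
        coe_eval₂RingHom, eval₂_X]
  exact congr($h p)

/-- The morphism `m : 𝔾ₐ × X ⟶ X` is given on functions by `P : K[X] → K[X][t]`. -/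
def IsGivenBy (m : Ga K ⊗ X ⟶ X) (P : RegularFunctions X →+* (RegularFunctions X)[X]) : Prop :=
  ∀ a, comorphism m a = polynomialToProd X (P a)

theorem IsGivenBy.comorphism_lift {m : Ga K ⊗ X ⟶ X}
    {P : RegularFunctions X →+* (RegularFunctions X)[X]} (h : IsGivenBy m P)
    (g : T ⟶ Ga K) (x : T ⟶ X) (a : RegularFunctions X) :
    comorphism (lift g x ≫ m) a = (P a).eval₂ (comorphism x) (comorphism g (Ga.coord K)) := by
  rw [comorphism_comp, h, comorphism_lift_polynomialToProd]

theorem exists_isGivenBy [CompactSpace X.left] [QuasiSeparatedSpace X.left] (m : Ga K ⊗ X ⟶ X) :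
    ∃ P : RegularFunctions X →+* (RegularFunctions X)[X], IsGivenBy m P := by
  let e := RingEquiv.ofBijective _ (polynomialToProd_bijective X)
  exact ⟨e.symm.toRingHom.comp (comorphism m), fun a => (e.apply_symm_apply _).symm⟩

theorem IsGivenBy.comorphism_lift_lift {m : Ga K ⊗ X ⟶ X}
    {P : RegularFunctions X →+* (RegularFunctions X)[X]} (h : IsGivenBy m P)
    (g g' : T ⟶ Ga K) (x : T ⟶ X) (a : RegularFunctions X) :
    comorphism (lift g (lift g' x ≫ m) ≫ m) a = ((P a).map P).eval₂
      (eval₂RingHom (comorphism x) (comorphism g' (Ga.coord K))) (comorphism g (Ga.coord K)) := by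
  rw [h.comorphism_lift, eval₂_map]
  congr 1
  ext b
  exact h.comorphism_lift g' x b

theorem IsGivenBy.comorphism_lift_add {m : Ga K ⊗ X ⟶ X}
    {P : RegularFunctions X →+* (RegularFunctions X)[X]} (h : IsGivenBy m P)
    (g g' : T ⟶ Ga K) (x : T ⟶ X) (a : RegularFunctions X) :
    comorphism (lift (lift g g' ≫ AddMonObj.add) x ≫ m) a = (taylor Polynomial.X ((P a).map C)).eval₂
      (eval₂RingHom (comorphism x) (comorphism g' (Ga.coord K))) (comorphism g (Ga.coord K)) := by
  rw [h.comorphism_lift, eval₂_taylor_X_map_C]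
  congr 1
  rw [comorphism_comp, comorphism_add_coord, map_add, ← comorphism_comp, ← comorphism_comp,
    lift_fst, lift_snd]

/-- A coaction on the functions of a quasi-affine scheme which is induced by a morphism defines an
action. -/
theorem IsCoaction.exists_gaAction [X.left.IsQuasiAffine]
    {P : RegularFunctions X →+* (RegularFunctions X)[X]} (hP : IsCoaction P)
    {m : Ga K ⊗ X ⟶ X} (hm : IsGivenBy m P) : ∃ α : GaAction X, α.act = m := by
  have zero_vadd : AddMonObj.zero ▷ X ≫ m = (λ_ X).hom := by
    refine hom_ext_of_comorphism fun a => ?_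
    have h : (AddMonObj.zero (X := Ga K)) ▷ X = lift (fst _ _ ≫ AddMonObj.zero) (snd _ _) := by
      ext1 <;> simp
    rw [h, hm.comorphism_lift, comorphism_comp, comorphism_zero_coord, map_zero, eval₂_at_zero,
      hP.coeff_zero, leftUnitor_hom]
  have add_vadd : AddMonObj.add ▷ X ≫ m = (α_ (Ga K) (Ga K) X).hom ≫ Ga K ◁ m ≫ m := by
    have h1 : (AddMonObj.add (X := Ga K)) ▷ X =
        lift (lift (fst _ _ ≫ fst _ _) (fst _ _ ≫ snd _ _) ≫ AddMonObj.add) (snd _ _) := by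
      ext1 <;> simp [← comp_lift]
    have h2 : (α_ (Ga K) (Ga K) X).hom ≫ Ga K ◁ m =
        lift (fst _ _ ≫ fst _ _) (lift (fst _ _ ≫ snd _ _) (snd _ _) ≫ m) := by
      ext1
      · simp
      · rw [Category.assoc, whiskerLeft_snd, lift_snd, ← Category.assoc]
        congr 1
        ext1 <;> simp
    refine hom_ext_of_comorphism fun a => ?_
    rw [h1, reassoc_of% h2, hm.comorphism_lift_lift, hm.comorphism_lift_add,
      (isCoaction_iff_taylor.mp hP).2]
  exact ⟨{ vadd := m, zero_vadd := zero_vadd, add_vadd := add_vadd }, rfl⟩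

theorem GaAction.lift_zero_act (α : GaAction X) :
    lift (toUnit X ≫ AddMonObj.zero) (𝟙 X) ≫ α.act = 𝟙 X := by
  have h : AddMonObj.zero ▷ X ≫ α.act = (λ_ X).hom := α.zero_vadd
  have h' := lift (toUnit X) (𝟙 X) ≫= h
  rwa [lift_whiskerRight_assoc, lift_leftUnitor_hom] at h'

theorem GaAction.lift_add_act (α : GaAction X) (g g' : T ⟶ Ga K) (x : T ⟶ X) :
    lift (lift g g' ≫ AddMonObj.add) x ≫ α.act = lift g (lift g' x ≫ α.act) ≫ α.act := by
  have h : AddMonObj.add ▷ X ≫ α.act = (α_ (Ga K) (Ga K) X).hom ≫ Ga K ◁ α.act ≫ α.act :=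
    α.add_vadd
  have h' := lift (lift g g') x ≫= h
  rwa [lift_whiskerRight_assoc, lift_lift_associator_hom_assoc, lift_whiskerLeft_assoc] at h'

theorem GaAction.isCoaction [CompactSpace X.left] [QuasiSeparatedSpace X.left] (α : GaAction X)
    {P : RegularFunctions X →+* (RegularFunctions X)[X]} (h : IsGivenBy α.act P) :
    IsCoaction P := by
  refine isCoaction_iff_taylor.mpr ⟨fun a => ?_, fun a => ?_⟩
  · have h0 := congr(comorphism $(α.lift_zero_act) a)
    rw [h.comorphism_lift, comorphism_comp, comorphism_zero_coord, map_zero, eval₂_at_zero,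
      comorphism_id, comorphism_id] at h0
    exact h0
  -- The projections form the universal point. Functions on this triple product are polynomials in
  -- two variables over `K[X]`, so equality of functions there is equality of polynomials.
  · let g : Ga K ⊗ Ga K ⊗ X ⟶ Ga K := fst _ _
    let g' : Ga K ⊗ Ga K ⊗ X ⟶ Ga K := snd _ _ ≫ fst _ _
    let x : Ga K ⊗ Ga K ⊗ X ⟶ X := snd _ _ ≫ snd _ _
    have h0 := congr(comorphism $(α.lift_add_act g g' x) a)
    rw [h.comorphism_lift_lift, h.comorphism_lift_add] at h0
    have hφ : eval₂RingHom (comorphism x) (comorphism g' (Ga.coord K)) =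
        (comorphism (snd (Ga K) (Ga K ⊗ X))).comp (polynomialToProd X) := by
      refine Polynomial.ringHom_ext (fun b => ?_) ?_
      · rw [coe_eval₂RingHom, eval₂_C, RingHom.comp_apply, polynomialToProd_C, comorphism_comp]
      · rw [coe_eval₂RingHom, eval₂_X, RingHom.comp_apply, polynomialToProd_X, comorphism_comp]
        rfl
    rw [hφ, ← eval₂_map, ← eval₂_map] at h0
    exact (Polynomial.map_injective _ (polynomialToProd_bijective X).1
      ((polynomialToProd_bijective (Ga K ⊗ X)).1 h0)).symm

theorem IsGivenBy.correspondsTo_iff [CompactSpace X.left] [QuasiSeparatedSpace X.left]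
    {α : GaAction X} {P : RegularFunctions X →+* (RegularFunctions X)[X]}
    (h : IsGivenBy α.act P) (D : Derivation K (RegularFunctions X) (RegularFunctions X)) :
    CorrespondsTo D α ↔ ∀ a, D a = (P a).coeff 1 := by
  let e := RingEquiv.ofBijective _ (polynomialToProd_bijective X)
  refine forall_congr' fun a => ?_
  have h1 : comorphism α.act a - (comorphism (snd (Ga K) X) a + parameter X *
      comorphism (snd (Ga K) X) (D a)) = e (P a - (C a + Polynomial.X * C (D a))) := by
    change _ = polynomialToProd X _
    rw [h, map_sub, map_add, map_mul, polynomialToProd_C, polynomialToProd_C, polynomialToProd_X]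
  have h2 : parameter X ^ 2 = e (Polynomial.X ^ 2) := by
    change _ = polynomialToProd X _
    rw [map_pow, polynomialToProd_X]
  rw [h1, h2, Ideal.mem_span_singleton, map_dvd_iff e, X_pow_dvd_iff]
  constructor
  · intro H
    have := H 1 one_lt_two
    rw [coeff_sub, coeff_add, coeff_C_succ, zero_add, coeff_X_mul, coeff_C_zero] at this
    exact (sub_eq_zero.mp this).symm
  · intro H d hd
    interval_cases d
    · simp [(α.isCoaction h).coeff_zero]
    · simp [H]

theorem IsGivenBy.map_algebraMap [CompactSpace X.left] [QuasiSeparatedSpace X.left]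
    {m : Ga K ⊗ X ⟶ X} {P : RegularFunctions X →+* (RegularFunctions X)[X]}
    (h : IsGivenBy m P) (c : K) :
    P (algebraMap K _ c) = C (algebraMap K _ c) := by
  refine (polynomialToProd_bijective X).1 ?_
  rw [← h, polynomialToProd_C, comorphism_algebraMap, comorphism_algebraMap]

end Comorphism

/-! ### Quasi-affine schemes inside their affine hull -/

section QuasiAffine

theorem mem_toSpecΓ_asIdeal_iff {X : Scheme.{u}} (x : X) (a : Γ(X, ⊤)) :
    a ∈ (X.toSpecΓ x).asIdeal ↔ x ∉ X.basicOpen a := by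
  rw [← Scheme.toSpecΓ_preimage_basicOpen]
  exact not_not.symm

/-- Divisibility of functions on an integral scheme is local on a cover by basic open subsets. -/
theorem dvd_of_forall_dvd_mul {X : Scheme.{u}} [IsIntegral X] {ι : Type u} (g : ι → Γ(X, ⊤))
    (hg : ⨆ i, X.basicOpen (g i) = ⊤) (b p : Γ(X, ⊤)) (hp : p ≠ 0)
    (h : ∀ i, p ∣ b * g i) : p ∣ b := by
  choose q hq using h
  let res (U : X.Opens) : Γ(X, ⊤) →+* Γ(X, U) := (X.presheaf.map (homOfLE le_top).op).hom
  have res_res {U V : X.Opens} (hUV : U ≤ V) (a : Γ(X, ⊤)) :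
      X.presheaf.map (homOfLE hUV).op (res V a) = res U a := by
    simp only [res]
    rw [← CommRingCat.comp_apply, ← Functor.map_comp]
    rfl
  have hunit (i : ι) : IsUnit (res (X.basicOpen (g i)) (g i)) :=
    X.toRingedSpace.isUnit_res_basicOpen (g i)
  -- The local quotient `b / p` is `q i / g i`; cancelling `p` will show that these agree on
  -- overlaps.
  have hex (i : ι) : ∃ s : Γ(X, X.basicOpen (g i)),
      s * res (X.basicOpen (g i)) (g i) = res (X.basicOpen (g i)) (q i) := by
    obtain ⟨v, hv⟩ := hunit i
    exact ⟨res _ (q i) * (v⁻¹).1, by rw [← hv, mul_assoc, Units.inv_mul, mul_one]⟩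
  choose s hs using hex
  have hcross (i j : ι) : q i * g j = q j * g i := by
    refine mul_left_cancel₀ hp ?_
    rw [← mul_assoc, ← hq, ← mul_assoc, ← hq]
    ring
  have hcompat : TopCat.Presheaf.IsCompatible X.sheaf.obj (fun i => X.basicOpen (g i)) s := by
    intro i j
    let U : X.Opens := X.basicOpen (g i) ⊓ X.basicOpen (g j)
    change X.presheaf.map (homOfLE (inf_le_left : U ≤ X.basicOpen (g i))).op (s i) =
      X.presheaf.map (homOfLE (inf_le_right : U ≤ X.basicOpen (g j))).op (s j)
    have hi := congr(X.presheaf.map (homOfLE (inf_le_left : U ≤ X.basicOpen (g i))).op $(hs i))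
    have hj := congr(X.presheaf.map (homOfLE (inf_le_right : U ≤ X.basicOpen (g j))).op $(hs j))
    have ui := (hunit i).map
      (X.presheaf.map (homOfLE (inf_le_left : U ≤ X.basicOpen (g i))).op).hom
    have uj := (hunit j).map
      (X.presheaf.map (homOfLE (inf_le_right : U ≤ X.basicOpen (g j))).op).hom
    rw [map_mul, res_res, res_res] at hi hj
    have ui' : IsUnit (res U (g i)) := (res_res _ _) ▸ ui
    have uj' : IsUnit (res U (g j)) := (res_res _ _) ▸ uj
    refine (ui'.mul uj').mul_left_injective ?_
    simp only
    rw [← mul_assoc, hi, mul_comm (res U (g i)), ← mul_assoc, hj, ← map_mul, ← map_mul, hcross]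
  obtain ⟨t, ht, -⟩ := X.sheaf.existsUnique_gluing (fun i => X.basicOpen (g i)) s hcompat
  let t' : Γ(X, ⊤) := X.presheaf.map (eqToHom hg.symm).op t
  have ht' (i : ι) : res (X.basicOpen (g i)) t' = s i := by
    rw [← ht i]
    simp only [res, t']
    change (X.presheaf.map _ ≫ X.presheaf.map _) t = _
    rw [← Functor.map_comp]
    rfl
  refine ⟨t', X.sheaf.eq_of_locally_eq' (fun i => X.basicOpen (g i)) ⊤
    (fun i => homOfLE le_top) hg.ge _ _ fun i => ?_⟩
  change res _ b = res _ (p * t')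
  refine (hunit i).mul_left_injective ?_
  simp only
  rw [map_mul, ht', mul_assoc, hs, ← map_mul, ← map_mul, hq]

/-- The image of `X` is open and quasi-compact, so finitely many functions cut out its complement.
Finiteness is what later permits a product over the family. -/
theorem exists_finite_basicOpen_cover (X : Scheme.{u}) [X.IsQuasiAffine] :
    ∃ t : Finset Γ(X, ⊤), ∀ z : Spec Γ(X, ⊤),
      z ∈ Set.range X.toSpecΓ ↔ ∃ a ∈ t, a ∉ z.asIdeal := by
  have h : IsCompact (X.toSpecΓ.opensRange : Set (Spec Γ(X, ⊤))) :=
    isCompact_range X.toSpecΓ.continuous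
  obtain ⟨t, ht⟩ := PrimeSpectrum.isCompact_isOpen_iff.mp ⟨h, X.toSpecΓ.opensRange.2⟩
  refine ⟨t, fun z => (Set.ext_iff.mp ht z).symm.trans ?_⟩
  exact (not_congr (PrimeSpectrum.mem_zeroLocus _ _)).trans Set.not_subset

/-- The kernel of a locally nilpotent derivation of the functions on an integral quasi-affine
scheme contains a nonzero function whose locus of non-vanishing in the affine hull lies in the
scheme. -/
theorem exists_kernel_basicOpen_le {K : Type u} [Field K] [CharZero K]
    (X : Over (Spec (CommRingCat.of K))) [IsIntegral X.left] [X.left.IsQuasiAffine]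
    {D : Derivation K (RegularFunctions X) (RegularFunctions X)} (hD : IsLocallyNilpotent D) :
    ∃ f : RegularFunctions X, f ≠ 0 ∧ D f = 0 ∧
      ∀ z : Spec Γ(X.left, ⊤), f ∉ z.asIdeal → z ∈ Set.range X.left.toSpecΓ := by
  obtain ⟨t, ht⟩ := exists_finite_basicOpen_cover X.left
  have hcover (x : X.left) : ∃ i : t, x ∈ X.left.basicOpen i.1 := by
    obtain ⟨a, ha, hax⟩ := (ht _).mp ⟨x, rfl⟩
    refine ⟨⟨a, ha⟩, ?_⟩
    by_contra hn
    exact hax ((mem_toSpecΓ_asIdeal_iff x a).mpr hn)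
  obtain ⟨f, hfI, hf0, hDf⟩ := exists_mem_span_of_saturated hD (fun i : t => i.1)
    (by
      obtain ⟨i, hi⟩ := hcover (Classical.arbitrary X.left)
      refine ⟨i, fun h0 => ?_⟩
      rw [h0, Scheme.basicOpen_zero] at hi
      exact hi)
    (dvd_of_forall_dvd_mul (X := X.left) (fun i : t => i.1)
      (top_le_iff.mp fun x _ => TopologicalSpace.Opens.mem_iSup.mpr (hcover x)))
  refine ⟨f, hf0, hDf, fun z hz => ?_⟩
  by_contra hn
  -- At a point outside `X` all generators vanish, hence so does `f`.
  refine hz (Ideal.span_le.mpr ?_ hfI)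
  rintro _ ⟨i, rfl⟩
  by_contra hi
  exact hn ((ht z).mpr ⟨i.1, i.2, hi⟩)

/-- A ring homomorphism `P : K[X] → K[X][t]` which is the identity modulo a `P`-invariant function
`f` is induced by a morphism `𝔾ₐ × X ⟶ X` if the non-vanishing locus of `f` in the affine
hull of `X` lies in `X`. -/
theorem exists_isGivenBy_of_invariant {K : Type u} [Field K]
    (X : Over (Spec (CommRingCat.of K))) [X.left.IsQuasiAffine]
    {P : RegularFunctions X →+* (RegularFunctions X)[X]}
    (hK : ∀ c : K, P (algebraMap K _ c) = C (algebraMap K _ c))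
    {f : RegularFunctions X} (hPf : P f = C f) (hf : ∀ a, C f ∣ P a - C a)
    (hrange : ∀ z : Spec Γ(X.left, ⊤), f ∉ z.asIdeal → z ∈ Set.range X.left.toSpecΓ) :
    ∃ m : Ga K ⊗ X ⟶ X, IsGivenBy m P := by
  let W := Ga K ⊗ X
  let φ : Γ(X.left, ⊤) ⟶ Γ(W.left, ⊤) := CommRingCat.ofHom ((polynomialToProd X).comp P)
  let ψ : W.left ⟶ Spec Γ(X.left, ⊤) := W.left.toSpecΓ ≫ Spec.map φ
  have hψ : Set.range ψ ⊆ Set.range X.left.toSpecΓ := by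
    rintro _ ⟨w, rfl⟩
    have hmem (a : Γ(X.left, ⊤)) : a ∈ (ψ w).asIdeal ↔ φ a ∈ (W.left.toSpecΓ w).asIdeal := Iff.rfl
    -- Where `f` vanishes, `P` is the identity modulo `f`, so `ψ` agrees there with the second
    -- projection; elsewhere the invariance of `f` keeps the image in its nonvanishing locus.
    by_cases hw : comorphism (snd (Ga K) X) f ∈ (W.left.toSpecΓ w).asIdeal
    · refine ⟨(snd (Ga K) X).left w, ?_⟩
      have h1 : X.left.toSpecΓ ((snd (Ga K) X).left w) =
          Spec.map (snd (Ga K) X).left.appTop (W.left.toSpecΓ w) :=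
        congr($(Scheme.toSpecΓ_naturality (snd (Ga K) X).left) w)
      rw [h1]
      refine PrimeSpectrum.ext (Ideal.ext fun a => ?_)
      change comorphism (snd (Ga K) X) a ∈ (W.left.toSpecΓ w).asIdeal ↔
        polynomialToProd X (P a) ∈ (W.left.toSpecΓ w).asIdeal
      obtain ⟨r, hr⟩ := hf a
      have h2 : polynomialToProd X (P a) = comorphism (snd (Ga K) X) f * polynomialToProd X r +
          comorphism (snd (Ga K) X) a := by
        rw [← polynomialToProd_C, ← map_mul, ← hr, map_sub, polynomialToProd_C, sub_add_cancel]
      rw [h2]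
      exact (Ideal.add_mem_iff_right _ (Ideal.mul_mem_right _ _ hw)).symm
    · refine hrange _ fun h => hw ?_
      rw [hmem] at h
      change polynomialToProd X (P f) ∈ _ at h
      rwa [hPf, polynomialToProd_C] at h
  let m := IsOpenImmersion.lift X.left.toSpecΓ ψ hψ
  have hm : m ≫ X.left.toSpecΓ = ψ := IsOpenImmersion.lift_fac _ _ _
  have happ : m.appTop = φ := by
    have h1 := congr(Scheme.Hom.appTop $hm)
    rw [Scheme.Hom.comp_appTop, Scheme.Hom.comp_appTop, Scheme.toSpecΓ_appTop,
      Scheme.toSpecΓ_appTop, Scheme.ΓSpecIso_naturality, cancel_epi] at h1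
    exact h1
  have hover : m ≫ X.hom = W.hom := by
    have : IsAffine ((Functor.fromPUnit (Spec (CommRingCat.of K))).obj X.right) :=
      inferInstanceAs (IsAffine (Spec (CommRingCat.of K)))
    refine ext_of_isAffine ?_
    rw [Scheme.Hom.comp_appTop, happ]
    have h1 : (Scheme.ΓSpecIso (CommRingCat.of K)).inv ≫ X.hom.appTop ≫ φ =
        (Scheme.ΓSpecIso (CommRingCat.of K)).inv ≫ W.hom.appTop := by
      refine CommRingCat.hom_ext (RingHom.ext fun c => ?_)
      change polynomialToProd X (P (algebraMap K (RegularFunctions X) c)) =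
        algebraMap K (RegularFunctions W) c
      rw [hK, polynomialToProd_C, comorphism_algebraMap]
    exact (cancel_epi _).mp h1
  exact ⟨Over.homMk m hover, fun a => congr($happ a)⟩

end QuasiAffine

/-! ### The three assertions -/

section Main

theorem GaAction.act_eq_snd_iff {K : Type u} [Field K]
    (X : Over (Spec (CommRingCat.of K))) [X.left.IsQuasiAffine] {α : GaAction X}
    {P : RegularFunctions X →+* (RegularFunctions X)[X]} (hP : IsGivenBy α.act P) :
    α.act = snd (Ga K) X ↔ ∀ a, P a = C a := by
  constructor
  · intro h a
    refine (polynomialToProd_bijective X).1 ?_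
    rw [← hP, polynomialToProd_C, h]
  · intro h
    refine hom_ext_of_comorphism fun a => ?_
    rw [hP, h, polynomialToProd_C]

variable {K : Type u} [Field K] [CharZero K] (X : Over (Spec (CommRingCat.of K)))
  [X.left.IsQuasiAffine]

theorem exists_gaAction_of_isGivenBy_expHom
    {D : Derivation K (RegularFunctions X) (RegularFunctions X)} (hD : IsLocallyNilpotent D)
    {m : Ga K ⊗ X ⟶ X} (hm : IsGivenBy m (expHom D hD)) :
    ∃ α : GaAction X, α.act = m ∧ CorrespondsTo D α := by
  obtain ⟨α, hα⟩ := (isCoaction_expHom D hD).exists_gaAction hm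
  refine ⟨α, hα, ?_⟩
  rw [← hα] at hm
  exact (hm.correspondsTo_iff D).mpr fun a => by simp [coeff_expHom]

theorem exists_smul_correspondsTo [IsIntegral X.left]
    {D : Derivation K (RegularFunctions X) (RegularFunctions X)} (hD : IsLocallyNilpotent D) :
    ∃ f : RegularFunctions X, f ≠ 0 ∧ D f = 0 ∧ ∃ α : GaAction X, CorrespondsTo (f • D) α := by
  obtain ⟨f, hf0, hDf, hrange⟩ := exists_kernel_basicOpen_le X hD
  refine ⟨f, hf0, hDf, ?_⟩
  have hfD := hD.smul hDf
  obtain ⟨m, hm⟩ := exists_isGivenBy_of_invariant X (P := expHom (f • D) hfD) (f := f)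
    (fun c => expHom_of_apply_eq_zero _ _ (Derivation.map_algebraMap _ c))
    (expHom_of_apply_eq_zero _ _ (by rw [Derivation.smul_apply, hDf, smul_zero]))
    -- For `n ≥ 1` the coefficient is `f^n D^n a / n!`, divisible by `f`; the constant term cancels
    -- against `C a`.
    (fun a => by
      rw [C_dvd_iff_dvd_coeff]
      intro n
      rw [coeff_sub, coeff_expHom, iterate_smul_derivation hDf]
      cases n with
      | zero => simp
      | succ n =>
        rw [coeff_C_succ, sub_zero, pow_succ', mul_assoc, ← mul_smul_comm]
        exact dvd_mul_right _ _)
    hrange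
  obtain ⟨α, -, hα⟩ := exists_gaAction_of_isGivenBy_expHom X hfD hm
  exact ⟨α, hα⟩

theorem exists_correspondsTo_smul
    {D : Derivation K (RegularFunctions X) (RegularFunctions X)} (hD : IsLocallyNilpotent D)
    {α : GaAction X} (hα : CorrespondsTo D α) {f : RegularFunctions X} (hf : D f = 0) :
    ∃ β : GaAction X, CorrespondsTo (f • D) β := by
  obtain ⟨P, hP⟩ := exists_isGivenBy α.act
  obtain rfl := (α.isCoaction hP).eq_expHom D ((hP.correspondsTo_iff D).mp hα) hD
  -- The reparametrised time `f(x) t`; acting for this time replaces `t` by `f t` in `exp (tD)`.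
  let s : Ga K ⊗ X ⟶ Ga K := (gaRepresentableBy K).homEquiv.symm
    (comorphism (snd (Ga K) X) f * parameter X : RegularFunctions (Ga K ⊗ X))
  have hs : comorphism s (Ga.coord K) = comorphism (snd (Ga K) X) f * parameter X :=
    (gaRepresentableBy K).homEquiv.apply_symm_apply _
  have hm : IsGivenBy (lift s (snd _ _) ≫ α.act) (expHom (f • D) (hD.smul hf)) := by
    intro a
    rw [hP.comorphism_lift, expHom_smul D hD hf, hs, polynomialToProd, coe_eval₂RingHom,
      eval₂_comp, eval₂_mul, eval₂_C, eval₂_X]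
  obtain ⟨β, -, hβ⟩ := exists_gaAction_of_isGivenBy_expHom X (hD.smul hf) hm
  exact ⟨β, hβ⟩

theorem exists_isNontrivial_iff [IsIntegral X.left] :
    (∃ α : GaAction X, α.IsNontrivial) ↔
      ∃ D : Derivation K (RegularFunctions X) (RegularFunctions X),
        IsLocallyNilpotent D ∧ D ≠ 0 := by
  constructor
  · rintro ⟨α, hα⟩
    obtain ⟨P, hP⟩ := exists_isGivenBy α.act
    have hc := α.isCoaction hP
    let D := hc.derivation hP.map_algebraMap
    have hD : ∀ a, D a = (P a).coeff 1 := fun a => rfl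
    have hLN := hc.isLocallyNilpotent D hD
    refine ⟨D, hLN, fun h0 => hα ?_⟩
    refine (GaAction.act_eq_snd_iff X hP).mpr fun a => ?_
    rw [hc.eq_expHom D hD hLN]
    exact expHom_of_apply_eq_zero D hLN (by rw [h0, Derivation.coe_zero, Pi.zero_apply])
  · rintro ⟨D, hD, hD0⟩
    obtain ⟨f, hf0, hDf, α, hα⟩ := exists_smul_correspondsTo X hD
    obtain ⟨P, hP⟩ := exists_isGivenBy α.act
    refine ⟨α, fun h => hD0 (Derivation.ext fun a => ?_)⟩
    have h1 := (hP.correspondsTo_iff _).mp hα a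
    rw [(GaAction.act_eq_snd_iff X hP).mp h a, coeff_C_succ, Derivation.smul_apply,
      smul_eq_mul] at h1
    exact (mul_eq_zero.mp h1).resolve_left hf0

end Main

end QuasiAffineLND

end

theorem mainTheorem4 (K : Type u) [Field K] [IsAlgClosed K] [CharZero K]
    (X : Over (Spec (CommRingCat.of K))) [IsIntegral X.left] [X.left.IsQuasiAffine]
    [LocallyOfFiniteType X.hom] :
    (∀ D : Derivation K (QuasiAffineLND.RegularFunctions X) (QuasiAffineLND.RegularFunctions X),
      QuasiAffineLND.IsLocallyNilpotent D →
        ∃ f : QuasiAffineLND.RegularFunctions X, f ≠ 0 ∧ D f = 0 ∧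
          ∃ α : QuasiAffineLND.GaAction X, QuasiAffineLND.CorrespondsTo (f • D) α) ∧
    (∀ D : Derivation K (QuasiAffineLND.RegularFunctions X) (QuasiAffineLND.RegularFunctions X),
      QuasiAffineLND.IsLocallyNilpotent D →
        (∃ α : QuasiAffineLND.GaAction X, QuasiAffineLND.CorrespondsTo D α) →
          ∀ f : QuasiAffineLND.RegularFunctions X, D f = 0 →
            ∃ β : QuasiAffineLND.GaAction X, QuasiAffineLND.CorrespondsTo (f • D) β) ∧
    ((∃ α : QuasiAffineLND.GaAction X, α.IsNontrivial) ↔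
      ∃ D : Derivation K (QuasiAffineLND.RegularFunctions X) (QuasiAffineLND.RegularFunctions X),
        QuasiAffineLND.IsLocallyNilpotent D ∧ D ≠ 0) := by
  refine ⟨fun D hD => QuasiAffineLND.exists_smul_correspondsTo X hD, ?_,
    QuasiAffineLND.exists_isNontrivial_iff X⟩
  rintro D hD ⟨α, hα⟩ f hf
  exact QuasiAffineLND.exists_correspondsTo_smul X hD hα hf
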